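/- Let $\alpha\ge 16$ be an even integer. A prime coding with coefficients $\xi=(\xi_m)_{m\ge 0}$, where $0<\xi_0<\xi_1<\xi_2<\cdots$, is the function $\psi:[0,\infty)\to[0,\infty)$ given by $\psi(x)=\xi_m(x-m)+\sum_{j<m}\xi_j$ for $x\in[m,m+1]$, $m\in\mathbb N$. For $k\in[4,\alpha/2]$ let $$D_I(k)=\{(x,y): x\ge 2,\ y\ge x,\ xy\le k\},\qquad D_S(k)=\{(x,y): x\ge 2,\ y\ge x,\ \alpha-k\le xy\le \alpha-4\},$$ let $\widehat A_I(\psi(k))$ and $\widehat A_S(\psi(k))$ be the areas of $(\psi\times\psi)(D_I(k))$ and $(\psi\times\psi)(D_S(k))$, regarded as functions of $u=\psi(k)$, and let $\widehat A_T=\widehat A_I+\widehat A_S$. For each integer $k_0\in\{4,\dots,\alpha/2-1\}$ there are unique real polynomials $P_{I,k_0}$ and $P_{S,k_0}$ in the variables $X_0,X_1,X_2,\dots$, depending only on $\alpha$ and $k_0$ and homogeneous of degree $2$, such that for every prime coding $\psi$ with coefficients $\xi$ and all $k\in[k_0,k_0+1]$ (derivatives with respect to $u=\psi(k)$ on $[\psi(k_0),\psi(k_0+1)]$,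 one-sided at the end points) $$\widehat A_I''(\psi(k))=\frac{P_{I,k_0}(\xi)}{\xi_{k_0}^2\,k},\qquad \widehat A_S''(\psi(k))=\frac{P_{S,k_0}(\xi)}{\xi_{k_0}^2(\alpha-k)}.$$ Let $\psi$ be a prime coding with coefficients $\xi$, and let $x_{k_0}=P_{I,k_0}(\xi)$ and $y_{k_0}=P_{S,k_0}(\xi)$ be the coordinates of its essential points $P_{k_0}=(x_{k_0},y_{k_0})$, $k_0=4,\dots,\alpha/2-1$. Then $(x_{k_0},y_{k_0})$ is the only pair of real numbers with $$\widehat A_T''(\psi(k))=\frac{1}{\xi_{k_0}^2}\Bigl(\frac{x_{k_0}}{k}+\frac{y_{k_0}}{\alpha-k}\Bigr)\qquad\text{for all }k\in[k_0,k_0+1],$$ and moreover: (i) $0<x_4\le x_5\le\cdots\le x_{\alpha/2-1}$, and for $5\le k_0\le\alpha/2-1$, $x_{k_0-1}=x_{k_0}$ if and only if $k_0$ is prime; (ii) $y_4\le y_5\le\cdots\le y_{\alpha/2-1}<0$, and for $5\le k_0\le\alpha/2-1$, $y_{k_0-1}=y_{k_0}$ if and only if $\alpha-k_0$ is prime. 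-/

import Mathlib

open Set MeasureTheory

noncomputable section

/-- A coding function `ψ : [0, ∞) → ℝ`: it vanishes at `0`, is continuous, and its restriction to each
`[m, m + 1]` is of class `C¹` with positive derivative (one-sided at the end points).
Only the values of `ψ` on `[0, ∞)` matter. -/
structure IsCodingFunction (ψ : ℝ → ℝ) : Prop where
  map_zero : ψ 0 = 0
  continuousOn : ContinuousOn ψ (Ici 0)
  contDiffOn : ∀ m : ℕ, ContDiffOn ℝ 1 ψ (Icc (m : ℝ) (m + 1))
  deriv_pos : ∀ m : ℕ, ∀ x ∈ Icc (m : ℝ) (m + 1), 0 < derivWithin ψ (Icc (m : ℝ) (m + 1)) x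

/-- `ψ` is a prime coding with coefficients `ξ 0, ξ 1, …`: a coding function that is affine with slope
`ξ m` on each `[m, m + 1]`, where `0 < ξ 0 < ξ 1 < ⋯`. -/
structure IsPrimeCoding (ψ : ℝ → ℝ) (ξ : ℕ → ℝ) : Prop where
  coding : IsCodingFunction ψ
  affine : ∀ m : ℕ, ∀ x ∈ Icc (m : ℝ) (m + 1),
    ψ x = ξ m * (x - m) + ∑ j ∈ Finset.range m, ξ j
  pos : 0 < ξ 0
  strictMono : StrictMono ξ

/-- The inverse `ψ⁻¹ : ψ([0, ∞)) → [0, ∞)` of a coding function. -/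
def codingInv (ψ : ℝ → ℝ) (u : ℝ) : ℝ := Function.invFunOn ψ (Ici 0) u

/-- The region `x ≥ 2`, `y ≥ x`, `x y ≤ k`. -/
def lowerRegion (k : ℝ) : Set (ℝ × ℝ) := {p | 2 ≤ p.1 ∧ p.1 ≤ p.2 ∧ p.1 * p.2 ≤ k}

/-- The region `x ≥ 2`, `y ≥ x`, `α - k ≤ x y ≤ α - 4`. -/
def upperRegion (α : ℕ) (k : ℝ) : Set (ℝ × ℝ) :=
  {p | 2 ≤ p.1 ∧ p.1 ≤ p.2 ∧ (α : ℝ) - k ≤ p.1 * p.2 ∧ p.1 * p.2 ≤ (α : ℝ) - 4}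

/-- The lower area as a function of `u = ψ k`: the area of the image under `ψ × ψ` of the lower region
of `k`. -/
def lowerArea (ψ : ℝ → ℝ) (u : ℝ) : ℝ :=
  volume.real (Prod.map ψ ψ '' lowerRegion (codingInv ψ u))

/-- The upper area as a function of `u = ψ k`: the area of the image under `ψ × ψ` of the upper region
of `k`. -/
def upperArea (ψ : ℝ → ℝ) (α : ℕ) (u : ℝ) : ℝ :=
  volume.real (Prod.map ψ ψ '' upperRegion α (codingInv ψ u))

/-- The total area as a function of `u = ψ k`. -/
def totalArea (ψ : ℝ → ℝ) (α : ℕ) (u : ℝ) : ℝ := lowerArea ψ u + upperArea ψ α u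

/-- On the set `s`, the function `f` is twice differentiable with second derivative `f''`
(derivatives being taken within `s`, hence one-sided at the end points of an interval). -/
def HasSecondDerivOn (f f'' : ℝ → ℝ) (s : Set ℝ) : Prop :=
  ∃ f' : ℝ → ℝ, (∀ u ∈ s, HasDerivWithinAt f (f' u) s u) ∧
    ∀ u ∈ s, HasDerivWithinAt f' (f'' u) s u

/-- `P` is a lower essential polynomial of `k₀`: for every prime coding `ψ` with coefficients `ξ`, the
value of `P` at `ξ` is what remains of the second derivative of the lower area on
`[ψ k₀, ψ (k₀ + 1)]` when the factor `1 / (ξ_{k₀}² k)`, with `k = ψ⁻¹ u`, is removed. -/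
def IsLowerEssentialPolynomial (k₀ : ℕ) (P : MvPolynomial ℕ ℝ) : Prop :=
  ∀ (ψ : ℝ → ℝ) (ξ : ℕ → ℝ), IsPrimeCoding ψ ξ →
    HasSecondDerivOn (lowerArea ψ)
      (fun u => 1 / (ξ k₀ ^ 2 * codingInv ψ u) * MvPolynomial.eval ξ P)
      (Icc (ψ k₀) (ψ (k₀ + 1)))

/-- `Q` is an upper essential polynomial of `k₀`: for every prime coding `ψ` with coefficients `ξ`, the
value of `Q` at `ξ` is what remains of the second derivative of the upper area on
`[ψ k₀, ψ (k₀ + 1)]` when the factor `1 / (ξ_{k₀}² (α - k))`, with `k = ψ⁻¹ u`, is removed. -/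
def IsUpperEssentialPolynomial (α k₀ : ℕ) (Q : MvPolynomial ℕ ℝ) : Prop :=
  ∀ (ψ : ℝ → ℝ) (ξ : ℕ → ℝ), IsPrimeCoding ψ ξ →
    HasSecondDerivOn (upperArea ψ α)
      (fun u => 1 / (ξ k₀ ^ 2 * ((α : ℝ) - codingInv ψ u)) * MvPolynomial.eval ξ Q)
      (Icc (ψ k₀) (ψ (k₀ + 1)))

/-- The second derivative of the total area on `[ψ k₀, ψ (k₀ + 1)]` is
`x / (ξ_{k₀}² k) + y / (ξ_{k₀}² (α - k))`, with `k = ψ⁻¹ u`. -/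
def TotalAreaHasCoefficients (ψ : ℝ → ℝ) (ξ : ℕ → ℝ) (α k₀ : ℕ) (x y : ℝ) : Prop :=
  HasSecondDerivOn (totalArea ψ α)
    (fun u => 1 / (ξ k₀ ^ 2 * codingInv ψ u) * x
      + 1 / (ξ k₀ ^ 2 * ((α : ℝ) - codingInv ψ u)) * y)
    (Icc (ψ k₀) (ψ (k₀ + 1)))

end

/-! On `[2, ∞)` the slope of `ψ` is a step function, a sum of its jumps `s m = slopeJump ξ m`
carried by the half-lines `(m, ∞)`; here `s 0 = s 1 = 0` and `s m > 0` for `m ≥ 2`. The area of the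
image of a region is therefore its mass under a combination of Lebesgue measures on quadrants `x >
m`, `y > n` with weights `s m * s n`. In such a quadrant the region `x y ≤ k` has area `k log (k /
c) - k + c` with `c = m n`, once `k ≥ c`; its second derivative is `1 / k` after `c` and `0` before.

Grouping quadrants by `j = m n` and halving by symmetry in the diagonal, the lower area has second
derivative `jumpSum ξ n / k` in `k` on `[n, n + 1]`, where `jumpSum` is half the summatory function
of the Dirichlet square `s * s`. The affine change of variable `u = ψ k` contributes `1 / ξ_n²`. The
upper area is a constant minus the lower area at `α - k`. Hence `x k₀ = jumpSum ξ k₀` and `y k₀ =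
-jumpSum ξ (α - k₀ - 1)`.

Consecutive coordinates differ by half of `(s * s) k₀`, respectively `(s * s) (α - k₀)`. Both are
nonnegative and vanish exactly at primes, since only factorizations with both factors at least `2`
contribute. The carrying lemmas are `slopeMeasure_prod_hyperbolicRegion`,
`hasSecondDerivOn_hyperbolicArea` and `jumpConvolution_eq_zero_iff`. -/

/-! ### Slope jumps of a prime coding. -/

/-- The jump at `m` of the slope of a prime coding restricted to `[2, ∞)`. -/
def slopeJump {R : Type*} [CommRing R] (ξ : ℕ → R) (m : ℕ) : R :=
  if m < 2 then 0 else if m = 2 then ξ 2 else ξ m - ξ (m - 1)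

theorem slopeJump_of_lt {R : Type*} [CommRing R] (ξ : ℕ → R) {m : ℕ} (hm : m < 2) :
    slopeJump ξ m = 0 := by
  simp [slopeJump, hm]

theorem slopeJump_add_three {R : Type*} [CommRing R] (ξ : ℕ → R) (m : ℕ) :
    slopeJump ξ (m + 3) = ξ (m + 3) - ξ (m + 2) := by
  simp [slopeJump]

theorem map_slopeJump {R S : Type*} [CommRing R] [CommRing S] (f : R →+* S) (ξ : ℕ → R) (m : ℕ) :
    f (slopeJump ξ m) = slopeJump (fun i => f (ξ i)) m := by
  unfold slopeJump
  split_ifs <;> simp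

/-- Summation by parts; the constant `ξ 0 + ξ 1` is `ψ 2`, lost because the jumps start at `2`. -/
theorem sum_slopeJump_mul_sub (ξ : ℕ → ℝ) (x : ℝ) (n : ℕ) :
    ∑ m ∈ Finset.range (n + 3), slopeJump ξ m * (x - m) =
      ξ (n + 2) * (x - (n + 2 : ℕ)) + ∑ j ∈ Finset.range (n + 2), ξ j - (ξ 0 + ξ 1) := by
  induction n with
  | zero => simp [Finset.sum_range_succ, slopeJump]
  | succ n ih =>
    rw [Finset.sum_range_succ, ih, slopeJump_add_three, Finset.sum_range_succ _ (n + 2)]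
    push_cast
    ring

namespace IsPrimeCoding

variable {ψ : ℝ → ℝ} {ξ : ℕ → ℝ}

theorem coeff_pos (h : IsPrimeCoding ψ ξ) (m : ℕ) : 0 < ξ m :=
  h.pos.trans_le (h.strictMono.monotone m.zero_le)

theorem slopeJump_pos (h : IsPrimeCoding ψ ξ) {m : ℕ} (hm : 2 ≤ m) : 0 < slopeJump ξ m := by
  rw [slopeJump, if_neg (by omega)]
  split_ifs
  · exact h.coeff_pos 2
  · exact sub_pos.2 (h.strictMono (by omega))

theorem slopeJump_nonneg (h : IsPrimeCoding ψ ξ) (m : ℕ) : 0 ≤ slopeJump ξ m := by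
  rcases lt_or_ge m 2 with hm | hm
  · rw [slopeJump_of_lt ξ hm]
  · exact (h.slopeJump_pos hm).le

theorem map_natCast (h : IsPrimeCoding ψ ξ) (m : ℕ) : ψ m = ∑ j ∈ Finset.range m, ξ j := by
  simpa using h.affine m m (by simp)

theorem strictMonoOn (h : IsPrimeCoding ψ ξ) : StrictMonoOn ψ (Ici 0) := by
  intro s hs t ht hst
  have hs1 := Nat.floor_le (mem_Ici.1 hs)
  have hs2 := Nat.lt_floor_add_one s
  have ht1 := Nat.floor_le (mem_Ici.1 ht)
  have ht2 := Nat.lt_floor_add_one t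
  have es := h.affine ⌊s⌋₊ s ⟨hs1, hs2.le⟩
  have et := h.affine ⌊t⌋₊ t ⟨ht1, ht2.le⟩
  have ps := h.coeff_pos ⌊s⌋₊
  have pt := h.coeff_pos ⌊t⌋₊
  rcases (Nat.floor_mono hst.le).eq_or_lt with hf | hf
  · rw [es, et, ← hf]
    gcongr
  · have hsum : ∑ j ∈ Finset.range (⌊s⌋₊ + 1), ξ j ≤ ∑ j ∈ Finset.range ⌊t⌋₊, ξ j :=
      Finset.sum_le_sum_of_subset_of_nonneg (Finset.range_mono hf)
        fun j _ _ => (h.coeff_pos j).le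
    rw [Finset.sum_range_succ] at hsum
    have h1 : ξ ⌊s⌋₊ * (s - ⌊s⌋₊) < ξ ⌊s⌋₊ * 1 := by gcongr; linarith
    have h2 : 0 ≤ ξ ⌊t⌋₊ * (t - ⌊t⌋₊) := mul_nonneg pt.le (by linarith)
    linarith

theorem codingInv_map (h : IsPrimeCoding ψ ξ) {k : ℝ} (hk : 0 ≤ k) : codingInv ψ (ψ k) = k :=
  h.strictMonoOn.injOn.leftInvOn_invFunOn hk

/-- The cutoff `N` is free above `x`, so that the expansions at two points can be subtracted over a
common index set. -/
theorem sum_slopeJump_mul_posPart (h : IsPrimeCoding ψ ξ) {x : ℝ} (hx : 2 ≤ x) {N : ℕ}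
    (hN : x < N) :
    ∑ m ∈ Finset.range N, slopeJump ξ m * max (x - m) 0 = ψ x - (ξ 0 + ξ 1) := by
  have hx0 : 0 ≤ x := by linarith
  obtain ⟨n, hn⟩ : ∃ n, ⌊x⌋₊ = n + 2 :=
    ⟨⌊x⌋₊ - 2, by have : 2 ≤ ⌊x⌋₊ := Nat.le_floor (by exact_mod_cast hx); omega⟩
  have hl := Nat.floor_le hx0
  have hu := Nat.lt_floor_add_one x
  have hfl : ⌊x⌋₊ < N := (Nat.floor_lt hx0).2 hN
  rw [hn] at hl hu hfl
  rw [h.affine (n + 2) x ⟨hl, hu.le⟩, ← sum_slopeJump_mul_sub]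
  symm
  rw [← Finset.sum_subset (Finset.range_mono (show n + 3 ≤ N by omega))]
  · refine Finset.sum_congr rfl fun m hm => ?_
    have hm' : (m : ℝ) ≤ (n + 2 : ℕ) := by
      exact_mod_cast Nat.lt_succ_iff.1 (Finset.mem_range.1 hm)
    rw [max_eq_left (by linarith)]
  · intro m _ hm
    have hm' : ((n + 2 : ℕ) : ℝ) + 1 ≤ m := by
      exact_mod_cast (by simpa using hm : n + 3 ≤ m)
    rw [max_eq_right (by linarith), mul_zero]

end IsPrimeCoding

/-! ### The measure `dψ` on `[2, ∞)`. -/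

/-- The extension of `ψ` from `[0, ∞)` to `ℝ` by the identity. -/
def codingExtension (ψ : ℝ → ℝ) (x : ℝ) : ℝ := ψ (max x 0) + min x 0

theorem codingExtension_of_nonneg {ψ : ℝ → ℝ} {x : ℝ} (hx : 0 ≤ x) :
    codingExtension ψ x = ψ x := by
  simp [codingExtension, hx]

namespace IsPrimeCoding

variable {ψ : ℝ → ℝ} {ξ : ℕ → ℝ}

theorem continuous_codingExtension (h : IsPrimeCoding ψ ξ) : Continuous (codingExtension ψ) :=
  (h.coding.continuousOn.comp_continuous (by fun_prop) fun x => le_max_right x 0).add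
    (by fun_prop)

theorem strictMono_codingExtension (h : IsPrimeCoding ψ ξ) : StrictMono (codingExtension ψ) := by
  intro s t hst
  have hm : ψ (max s 0) ≤ ψ (max t 0) :=
    h.strictMonoOn.monotoneOn (le_max_right s 0) (le_max_right t 0) (max_le_max_right 0 hst.le)
  rcases lt_or_ge s 0 with hs | hs
  · have : min s 0 < min t 0 := by
      rw [min_eq_left hs.le]; exact lt_min hst hs
    exact add_lt_add_of_le_of_lt hm this
  · have ht := hs.trans hst.le
    simpa [codingExtension, hs, ht] using h.strictMonoOn hs ht hst

/-- This is the reason for extending `ψ`: an embedding of all of `ℝ` allows Lebesgue measure to be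
pulled back. -/
theorem measurableEmbedding_codingExtension (h : IsPrimeCoding ψ ξ) :
    MeasurableEmbedding (codingExtension ψ) :=
  h.continuous_codingExtension.measurableEmbedding h.strictMono_codingExtension.injective

end IsPrimeCoding

/-- The measure on `(2, ∞)` whose density is the slope of the prime coding with coefficients `ξ`. -/
noncomputable def slopeMeasure (ξ : ℕ → ℝ) : Measure ℝ :=
  Measure.sum fun m : ℕ => ENNReal.ofReal (slopeJump ξ m) • volume.restrict (Ioi (m : ℝ))

instance (ξ : ℕ → ℝ) : SFinite (slopeMeasure ξ) := by
  unfold slopeMeasure; infer_instance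

instance (ξ : ℕ → ℝ) : NullSingletonClass (slopeMeasure ξ) :=
  ⟨fun x => by simp [slopeMeasure, Measure.sum_apply]⟩

namespace IsPrimeCoding

variable {ψ : ℝ → ℝ} {ξ : ℕ → ℝ}

theorem slopeMeasure_Ioc (h : IsPrimeCoding ψ ξ) {s t : ℝ} :
    slopeMeasure ξ (Ioc s t) = ENNReal.ofReal (ψ (max t 2) - ψ (max s 2)) := by
  obtain ⟨N, hN⟩ := exists_nat_gt (max (max s 2) (max t 2))
  have hsN := (le_max_left _ _).trans_lt hN
  have htN := (le_max_right _ _).trans_lt hN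
  rw [slopeMeasure, Measure.sum_apply _ measurableSet_Ioc]
  have hterm (m : ℕ) : (ENNReal.ofReal (slopeJump ξ m) • volume.restrict (Ioi (m : ℝ))) (Ioc s t) =
      ENNReal.ofReal (slopeJump ξ m * (t - max s m)) := by
    rw [Measure.smul_apply, Measure.restrict_apply measurableSet_Ioc, Ioc_inter_Ioi,
      Real.volume_Ioc, smul_eq_mul, ENNReal.ofReal_mul (h.slopeJump_nonneg m)]
  simp_rw [hterm]
  rcases lt_or_ge t (max s 2) with hts | hts
  · rw [ENNReal.ofReal_of_nonpos, ENNReal.tsum_eq_zero]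
    · intro m
      rcases lt_or_ge m 2 with hm | hm
      · simp [slopeJump_of_lt ξ hm]
      · have : (2 : ℝ) ≤ m := by exact_mod_cast hm
        refine ENNReal.ofReal_of_nonpos (mul_nonpos_of_nonneg_of_nonpos (h.slopeJump_nonneg m) ?_)
        have := max_le_max_left s this
        linarith
    · have : ψ (max t 2) ≤ ψ (max s 2) := h.strictMonoOn.monotoneOn
        (mem_Ici.2 (by linarith [le_max_right t 2])) (mem_Ici.2 (by linarith [le_max_right s 2]))
        (max_le hts.le (le_max_right _ _))
      linarith
  have ht2 : max t 2 = t := max_eq_left ((le_max_right s 2).trans hts)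
  rw [ht2] at htN ⊢
  have hsum : ψ t - ψ (max s 2) =
      ∑ m ∈ Finset.range N, slopeJump ξ m * max (t - max s m) 0 := by
    have e1 := h.sum_slopeJump_mul_posPart ((le_max_right s 2).trans hts) htN
    have e2 := h.sum_slopeJump_mul_posPart (le_max_right s 2) hsN
    have : ψ t - ψ (max s 2) = (ψ t - (ξ 0 + ξ 1)) - (ψ (max s 2) - (ξ 0 + ξ 1)) := by ring
    rw [this, ← e1, ← e2, ← Finset.sum_sub_distrib]
    refine Finset.sum_congr rfl fun m _ => ?_
    rcases lt_or_ge m 2 with hm | hm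
    · simp [slopeJump_of_lt ξ hm]
    have hm2 : (2 : ℝ) ≤ m := by exact_mod_cast hm
    rw [← mul_sub]
    congr 1
    have hst : s ≤ t := (le_max_left s 2).trans hts
    have h2t : 2 ≤ t := (le_max_right s 2).trans hts
    rcases le_total (m : ℝ) s with h1 | h1
    · rw [max_eq_left h1, max_eq_left (hm2.trans h1), max_eq_left (by linarith),
        max_eq_left (by linarith), max_eq_left (by linarith)]
      ring
    · rw [max_eq_right h1, max_eq_right (a := max s 2 - m), sub_zero]
      have := max_le h1 hm2
      linarith
  rw [hsum, ENNReal.ofReal_sum_of_nonneg fun m _ =>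
    mul_nonneg (h.slopeJump_nonneg m) (le_max_right _ _), tsum_eq_sum (s := Finset.range N)]
  · refine Finset.sum_congr rfl fun m _ => ?_
    rw [ENNReal.ofReal_mul (h.slopeJump_nonneg m), ENNReal.ofReal_mul (h.slopeJump_nonneg m),
      ENNReal.ofReal_max, ENNReal.ofReal_zero, max_eq_left zero_le]
  · intro m hm
    have : (N : ℝ) ≤ m := by exact_mod_cast (by simpa using hm : N ≤ m)
    exact ENNReal.ofReal_of_nonpos (mul_nonpos_of_nonneg_of_nonpos (h.slopeJump_nonneg m)
      (by linarith [le_max_right s m]))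

theorem comap_codingExtension_Ioc (h : IsPrimeCoding ψ ξ) {s t : ℝ} (hst : s ≤ t) :
    volume.comap (codingExtension ψ) (Ioc s t) =
      ENNReal.ofReal (codingExtension ψ t - codingExtension ψ s) := by
  rw [h.measurableEmbedding_codingExtension.comap_apply,
    h.continuous_codingExtension.continuousOn.image_Ioc_of_strictMonoOn hst
      (h.strictMono_codingExtension.strictMonoOn _), Real.volume_Ioc]

theorem isLocallyFiniteMeasure_comap (h : IsPrimeCoding ψ ξ) :
    IsLocallyFiniteMeasure (volume.comap (codingExtension ψ)) :=
  have := IsFiniteMeasureOnCompacts.comap' (volume : Measure ℝ) h.continuous_codingExtension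
    h.measurableEmbedding_codingExtension
  inferInstance

/-- Both measures give `Ioc s t` the increment of `ψ` over its part above `2`, and half-open
intervals determine a locally finite measure. -/
theorem comap_codingExtension_restrict (h : IsPrimeCoding ψ ξ) :
    (volume.comap (codingExtension ψ)).restrict (Ici 2) = slopeMeasure ξ := by
  have := h.isLocallyFiniteMeasure_comap
  have hnull : volume.comap (codingExtension ψ) {2} = 0 := by
    rw [h.measurableEmbedding_codingExtension.comap_apply]; simp
  rw [← Measure.restrict_congr_set (Ioi_ae_eq_Ici' hnull)]
  refine Measure.ext_of_Ioc _ _ fun s t hst => ?_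
  rw [Measure.restrict_apply measurableSet_Ioc, Ioc_inter_Ioi, h.slopeMeasure_Ioc]
  rcases le_total (s ⊔ 2) t with hts | hts
  · have h2 : (0 : ℝ) ≤ max s 2 := by linarith [le_max_right s 2]
    rw [h.comap_codingExtension_Ioc hts, codingExtension_of_nonneg (h2.trans hts),
      codingExtension_of_nonneg h2, max_eq_left ((le_max_right s 2).trans hts)]
  · have ht2 : t ≤ 2 := by
      by_contra! hlt
      exact absurd hts (not_le.2 (max_lt hst hlt))
    have hs2 : s ≤ 2 := hst.le.trans ht2
    rw [Ioc_eq_empty (not_lt.2 hts), max_eq_right ht2, max_eq_right hs2]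
    simp

/-- The area of the image of a region under `ψ × ψ`. -/
theorem volume_image_prodMap (h : IsPrimeCoding ψ ξ) {s : Set (ℝ × ℝ)} (hs : MeasurableSet s)
    (hs2 : s ⊆ Ici 2 ×ˢ Ici 2) :
    volume (Prod.map ψ ψ '' s) = (slopeMeasure ξ).prod (slopeMeasure ξ) s := by
  have := h.isLocallyFiniteMeasure_comap
  have hemb := h.measurableEmbedding_codingExtension
  have himage : Prod.map ψ ψ '' s = Prod.map (codingExtension ψ) (codingExtension ψ) '' s := by
    refine image_congr fun p hp => ?_
    obtain ⟨h1, h2⟩ := hs2 hp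
    rw [mem_Ici] at h1 h2
    exact Prod.ext
      (codingExtension_of_nonneg (by linarith : (0 : ℝ) ≤ p.1)).symm
      (codingExtension_of_nonneg (by linarith : (0 : ℝ) ≤ p.2)).symm
  have hprod : (volume.comap (codingExtension ψ)).prod (volume.comap (codingExtension ψ)) =
      (volume : Measure (ℝ × ℝ)).comap (Prod.map (codingExtension ψ) (codingExtension ψ)) := by
    refine Measure.prod_eq fun a b _ _ => ?_
    rw [(hemb.prodMap hemb).comap_apply, prodMap_image_prod, Measure.volume_eq_prod,
      Measure.prod_prod, hemb.comap_apply, hemb.comap_apply]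
  rw [himage, ← (hemb.prodMap hemb).comap_apply, ← hprod, ← h.comap_codingExtension_restrict,
    Measure.prod_restrict, Measure.restrict_apply hs, inter_eq_left.2 hs2]

end IsPrimeCoding

/-! ### Area under a hyperbola in a quadrant. -/

/-- The area of the region `x > a`, `y > b`, `x y ≤ k` as a function of `k` and `c = a b`. -/
noncomputable def hyperbolicArea (k c : ℝ) : ℝ :=
  if c ≤ k then k * Real.log (k / c) - k + c else 0

/-- This is `log t ≤ t - 1` at `t = c / k`. -/
theorem hyperbolicArea_nonneg {k c : ℝ} (hc : 0 < c) : 0 ≤ hyperbolicArea k c := by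
  unfold hyperbolicArea
  split_ifs with h
  · have hk : 0 < k := hc.trans_le h
    have h1 := Real.log_le_sub_one_of_pos (div_pos hc hk)
    rw [← inv_div, Real.log_inv] at h1
    have h2 : k * (-Real.log (k / c)) ≤ k * ((k / c)⁻¹ - 1) := by gcongr
    have h3 : k * ((k / c)⁻¹ - 1) = c - k := by field_simp
    linarith
  · exact le_rfl

theorem measurableSet_hyperbolicQuadrant (a b k : ℝ) :
    MeasurableSet {p : ℝ × ℝ | a < p.1 ∧ b < p.2 ∧ p.1 * p.2 ≤ k} :=
  (measurableSet_lt measurable_const measurable_fst).inter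
    ((measurableSet_lt measurable_const measurable_snd).inter
      (measurableSet_le (measurable_fst.mul measurable_snd) measurable_const))

/-- The vertical section at `x` is `(b, k / x]`, nonempty only for `x < k / b`; its length is
integrated over `(a, k / b]`. -/
theorem volume_hyperbolicQuadrant {a b : ℝ} (ha : 0 < a) (hb : 0 < b) (k : ℝ) :
    volume {p : ℝ × ℝ | a < p.1 ∧ b < p.2 ∧ p.1 * p.2 ≤ k} =
      ENNReal.ofReal (hyperbolicArea k (a * b)) := by
  rcases lt_or_ge k (a * b) with hk | hk
  · rw [hyperbolicArea, if_neg (not_le.2 hk), ENNReal.ofReal_zero]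
    convert measure_empty (μ := (volume : Measure (ℝ × ℝ)))
    refine eq_empty_of_forall_notMem fun p ⟨h1, h2, h3⟩ => ?_
    have := mul_lt_mul'' h1 h2 ha.le hb.le
    linarith
  have hab : a ≤ k / b := (le_div_iff₀ hb).2 hk
  have hk0 : 0 < k := (mul_pos ha hb).trans_le hk
  have hsection (x : ℝ) :
      volume (Prod.mk x ⁻¹' {p : ℝ × ℝ | a < p.1 ∧ b < p.2 ∧ p.1 * p.2 ≤ k}) =
        (Ioc a (k / b)).indicator (fun x => ENNReal.ofReal (k / x - b)) x := by
    rcases le_or_gt x a with hx | hx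
    · rw [indicator_of_notMem (by simp [hx])]
      convert measure_empty (μ := (volume : Measure ℝ))
      exact eq_empty_of_forall_notMem fun y hy => absurd hy.1 (not_lt.2 hx)
    · have hx0 := ha.trans hx
      have : Prod.mk x ⁻¹' {p : ℝ × ℝ | a < p.1 ∧ b < p.2 ∧ p.1 * p.2 ≤ k} = Ioc b (k / x) := by
        ext y
        simp [hx, le_div_iff₀' hx0]
      rw [this, Real.volume_Ioc]
      by_cases hxk : x ≤ k / b
      · rw [indicator_of_mem (show x ∈ Ioc a (k / b) from ⟨hx, hxk⟩)]
      · rw [indicator_of_notMem fun h => hxk h.2]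
        refine ENNReal.ofReal_of_nonpos (sub_nonpos.2 ?_)
        rw [div_le_iff₀ hx0, ← div_le_iff₀' hb]
        exact (not_le.1 hxk).le
  have hne : ∀ x ∈ uIcc a (k / b), x ≠ 0 := fun x hx => by
    rw [uIcc_of_le hab] at hx
    exact (ha.trans_le hx.1).ne'
  have hdiv : IntervalIntegrable (fun x => k / x) volume a (k / b) :=
    ContinuousOn.intervalIntegrable (continuousOn_const.div continuousOn_id hne)
  have hint : IntervalIntegrable (fun x => k / x - b) volume a (k / b) :=
    hdiv.sub intervalIntegrable_const
  rw [Measure.volume_eq_prod, Measure.prod_apply (measurableSet_hyperbolicQuadrant a b k)]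
  simp_rw [hsection]
  rw [lintegral_indicator measurableSet_Ioc, ← ofReal_integral_eq_lintegral_ofReal,
    ← intervalIntegral.integral_of_le hab]
  · congr 1
    rw [intervalIntegral.integral_sub hdiv intervalIntegrable_const, hyperbolicArea, if_pos hk]
    simp_rw [div_eq_mul_inv k]
    rw [intervalIntegral.integral_const_mul, integral_inv_of_pos ha (by positivity),
      intervalIntegral.integral_const, ← div_eq_mul_inv, ← div_eq_mul_inv, div_div, mul_comm b a,
      smul_eq_mul]
    field_simp
    ring
  · exact (intervalIntegrable_iff_integrableOn_Ioc_of_le hab).1 hint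
  · refine (ae_restrict_iff' measurableSet_Ioc).2 (Filter.Eventually.of_forall fun x hx => ?_)
    have hx0 : 0 < x := ha.trans hx.1
    simp only [Pi.zero_apply, sub_nonneg]
    rw [le_div_iff₀ hx0, ← le_div_iff₀' hb]
    exact hx.2

/-! ### Areas of the regions as sums over products of jumps. -/

/-- The Dirichlet convolution square of the slope jumps. -/
def jumpConvolution {R : Type*} [CommRing R] (ξ : ℕ → R) (j : ℕ) : R :=
  ∑ p ∈ j.divisorsAntidiagonal, slopeJump ξ p.1 * slopeJump ξ p.2

theorem measurableSet_hyperbolicRegion (k : ℝ) :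
    MeasurableSet {p : ℝ × ℝ | 2 ≤ p.1 ∧ 2 ≤ p.2 ∧ p.1 * p.2 ≤ k} :=
  (measurableSet_le measurable_const measurable_fst).inter
    ((measurableSet_le measurable_const measurable_snd).inter
      (measurableSet_le (measurable_fst.mul measurable_snd) measurable_const))

theorem measurableSet_lowerRegion (k : ℝ) : MeasurableSet (lowerRegion k) :=
  (measurableSet_le measurable_const measurable_fst).inter
    ((measurableSet_le measurable_fst measurable_snd).inter
      (measurableSet_le (measurable_fst.mul measurable_snd) measurable_const))

theorem measurableSet_upperRegion (α : ℕ) (k : ℝ) : MeasurableSet (upperRegion α k) :=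
  (measurableSet_le measurable_const measurable_fst).inter
    ((measurableSet_le measurable_fst measurable_snd).inter
      ((measurableSet_le measurable_const (measurable_fst.mul measurable_snd)).inter
        (measurableSet_le (measurable_fst.mul measurable_snd) measurable_const)))

/-- A region whose vertical sections have at most one point is negligible. -/
theorem prod_null_of_subsingleton_sections {μ ν : Measure ℝ} [SFinite ν] [NullSingletonClass ν]
    {s : Set (ℝ × ℝ)} (hs : MeasurableSet s)
    (h : ∀ x y z, (x, y) ∈ s → (x, z) ∈ s → y = z) : μ.prod ν s = 0 :=
  (Measure.measure_prod_null hs).2 <| Filter.Eventually.of_forall fun x =>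
    Set.Subsingleton.measure_zero (fun y hy z hz => h x y z hy hz) ν

/-- Reflection in the diagonal; the overlap lies on the diagonal, which is null as `μ` has no atoms.
-/
theorem two_mul_prod_lowerRegion (μ : Measure ℝ) [SFinite μ] [NullSingletonClass μ] (k : ℝ) :
    2 * μ.prod μ (lowerRegion k) =
      μ.prod μ {p : ℝ × ℝ | 2 ≤ p.1 ∧ 2 ≤ p.2 ∧ p.1 * p.2 ≤ k} := by
  have hunion : {p : ℝ × ℝ | 2 ≤ p.1 ∧ 2 ≤ p.2 ∧ p.1 * p.2 ≤ k} =
      lowerRegion k ∪ Prod.swap ⁻¹' lowerRegion k := by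
    ext ⟨x, y⟩
    simp only [lowerRegion, mem_ofPred_eq, mem_union, mem_preimage, Prod.swap_prod_mk]
    constructor
    · rintro ⟨hx, hy, hk⟩
      rcases le_total x y with hxy | hxy
      · exact Or.inl ⟨hx, hxy, hk⟩
      · exact Or.inr ⟨hy, hxy, by rwa [mul_comm]⟩
    · rintro (⟨h1, h2, h3⟩ | ⟨h1, h2, h3⟩)
      · exact ⟨h1, h1.trans h2, h3⟩
      · exact ⟨h1.trans h2, h1, by rwa [mul_comm]⟩
  have hm := measurableSet_lowerRegion k
  have hdisj : AEDisjoint (μ.prod μ) (lowerRegion k) (Prod.swap ⁻¹' lowerRegion k) := by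
    refine prod_null_of_subsingleton_sections (hm.inter (measurable_swap hm)) ?_
    rintro x y z ⟨⟨_, h1, _⟩, ⟨_, h2, _⟩⟩ ⟨⟨_, h3, _⟩, ⟨_, h4, _⟩⟩
    exact (le_antisymm h2 h1).trans (le_antisymm h3 h4)
  rw [hunion, measure_union₀ (measurable_swap hm).nullMeasurableSet hdisj,
    ← Measure.map_apply measurable_swap hm, Measure.prod_swap, two_mul]

/-- The region is cut along `x y = α - k`, a null curve; `4 ≤ k` puts the lower piece inside the
whole. -/
theorem prod_upperRegion_add (μ : Measure ℝ) [SFinite μ] [NullSingletonClass μ] {α : ℕ} {k : ℝ}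
    (hk : 4 ≤ k) :
    μ.prod μ (upperRegion α k) + μ.prod μ (lowerRegion (α - k)) =
      μ.prod μ (lowerRegion (α - 4)) := by
  have hunion : lowerRegion (α - 4) = upperRegion α k ∪ lowerRegion (α - k) := by
    ext ⟨x, y⟩
    simp only [lowerRegion, upperRegion, mem_ofPred_eq, mem_union]
    constructor
    · rintro ⟨h1, h2, h3⟩
      rcases le_total ((α : ℝ) - k) (x * y) with h | h
      · exact Or.inl ⟨h1, h2, h, h3⟩
      · exact Or.inr ⟨h1, h2, h⟩
    · rintro (⟨h1, h2, _, h3⟩ | ⟨h1, h2, h3⟩)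
      · exact ⟨h1, h2, h3⟩
      · exact ⟨h1, h2, by linarith⟩
  have hdisj : AEDisjoint (μ.prod μ) (upperRegion α k) (lowerRegion (α - k)) := by
    refine prod_null_of_subsingleton_sections
      ((measurableSet_upperRegion α k).inter (measurableSet_lowerRegion _)) ?_
    rintro x y z ⟨⟨h0, _, h1, _⟩, ⟨_, _, h2⟩⟩ ⟨⟨_, _, h3, _⟩, ⟨_, _, h4⟩⟩
    dsimp only at h0 h1 h2 h3 h4
    exact mul_left_cancel₀ (by linarith : x ≠ 0)
      ((le_antisymm h2 h1).trans (le_antisymm h3 h4))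
  rw [hunion, measure_union₀ (measurableSet_lowerRegion _).nullMeasurableSet hdisj]

namespace IsPrimeCoding

variable {ψ : ℝ → ℝ} {ξ : ℕ → ℝ}

theorem jumpConvolution_nonneg (h : IsPrimeCoding ψ ξ) (j : ℕ) : 0 ≤ jumpConvolution ξ j :=
  Finset.sum_nonneg fun _ _ => mul_nonneg (h.slopeJump_nonneg _) (h.slopeJump_nonneg _)

theorem slopeMeasure_prod_hyperbolicRegion (h : IsPrimeCoding ψ ξ) {k : ℝ} {N : ℕ}
    (hk : k ≤ N) :
    (slopeMeasure ξ).prod (slopeMeasure ξ) {p : ℝ × ℝ | 2 ≤ p.1 ∧ 2 ≤ p.2 ∧ p.1 * p.2 ≤ k} =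
      ENNReal.ofReal (∑ j ∈ Finset.Icc 1 N, jumpConvolution ξ j * hyperbolicArea k j) := by
  have hterm (q : ℕ × ℕ) :
      ((ENNReal.ofReal (slopeJump ξ q.1) • volume.restrict (Ioi (q.1 : ℝ))).prod
        (ENNReal.ofReal (slopeJump ξ q.2) • volume.restrict (Ioi (q.2 : ℝ))))
          {p : ℝ × ℝ | 2 ≤ p.1 ∧ 2 ≤ p.2 ∧ p.1 * p.2 ≤ k} =
        ENNReal.ofReal
          (slopeJump ξ q.1 * slopeJump ξ q.2 * hyperbolicArea k (q.1 * q.2 : ℕ)) := by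
    obtain ⟨m, n⟩ := q
    rcases lt_or_ge m 2 with hm | hm
    · simp [slopeJump_of_lt ξ hm]
    rcases lt_or_ge n 2 with hn | hn
    · simp [slopeJump_of_lt ξ hn]
    have hm2 : (2 : ℝ) ≤ m := by exact_mod_cast hm
    have hn2 : (2 : ℝ) ≤ n := by exact_mod_cast hn
    have hset : {p : ℝ × ℝ | 2 ≤ p.1 ∧ 2 ≤ p.2 ∧ p.1 * p.2 ≤ k} ∩ Ioi (m : ℝ) ×ˢ Ioi (n : ℝ) =
        {p : ℝ × ℝ | m < p.1 ∧ n < p.2 ∧ p.1 * p.2 ≤ k} := by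
      ext p
      simp only [mem_inter_iff, mem_ofPred_eq, mem_prod, mem_Ioi]
      exact ⟨fun ⟨⟨_, _, h3⟩, h4, h5⟩ => ⟨h4, h5, h3⟩,
        fun ⟨h1, h2, h3⟩ => ⟨⟨hm2.trans h1.le, hn2.trans h2.le, h3⟩, h1, h2⟩⟩
    rw [Measure.prod_smul_left, Measure.prod_smul_right, Measure.prod_restrict,
      Measure.smul_apply, Measure.smul_apply,
      Measure.restrict_apply (measurableSet_hyperbolicRegion k), hset, ← Measure.volume_eq_prod,
      volume_hyperbolicQuadrant (by linarith) (by linarith), smul_eq_mul, smul_eq_mul,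
      ENNReal.ofReal_mul (mul_nonneg (h.slopeJump_nonneg m) (h.slopeJump_nonneg n)),
      ENNReal.ofReal_mul (h.slopeJump_nonneg m), mul_assoc]
    push_cast
    rfl
  rw [slopeMeasure, Measure.prod_sum, Measure.sum_apply _ (measurableSet_hyperbolicRegion k)]
  simp_rw [hterm]
  have hdisj : (↑(Finset.Icc 1 N) : Set ℕ).PairwiseDisjoint Nat.divisorsAntidiagonal := by
    intro i _ j _ hij
    refine Finset.disjoint_left.2 fun p hp hq => hij ?_
    rw [← (Nat.mem_divisorsAntidiagonal.1 hp).1, ← (Nat.mem_divisorsAntidiagonal.1 hq).1]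
  -- Pairs are grouped by their product `j`; those with product above `N ≥ k` contribute nothing, so
  -- the series is finite.
  rw [tsum_eq_sum (s := (Finset.Icc 1 N).biUnion Nat.divisorsAntidiagonal),
    Finset.sum_biUnion hdisj, ENNReal.ofReal_sum_of_nonneg]
  · refine Finset.sum_congr rfl fun j hj => ?_
    have hj0 : (0 : ℝ) < j := by exact_mod_cast (Finset.mem_Icc.1 hj).1
    rw [jumpConvolution, Finset.sum_mul, ENNReal.ofReal_sum_of_nonneg]
    · refine Finset.sum_congr rfl fun p hp => ?_
      rw [(Nat.mem_divisorsAntidiagonal.1 hp).1]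
    · exact fun p _ => mul_nonneg (mul_nonneg (h.slopeJump_nonneg _) (h.slopeJump_nonneg _))
        (hyperbolicArea_nonneg hj0)
  · intro j hj
    have hj0 : (0 : ℝ) < j := by exact_mod_cast (Finset.mem_Icc.1 hj).1
    exact mul_nonneg (h.jumpConvolution_nonneg j) (hyperbolicArea_nonneg hj0)
  · rintro ⟨m, n⟩ hq
    rcases lt_or_ge m 2 with hm | hm
    · simp [slopeJump_of_lt ξ hm]
    rcases lt_or_ge n 2 with hn | hn
    · simp [slopeJump_of_lt ξ hn]
    have hmn : 0 < m * n := Nat.mul_pos (by omega) (by omega)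
    have hN : N < m * n := by
      by_contra! hle
      exact hq (Finset.mem_biUnion.2 ⟨m * n, Finset.mem_Icc.2 ⟨hmn, hle⟩,
        Nat.mem_divisorsAntidiagonal.2 ⟨rfl, hmn.ne'⟩⟩)
    have hN' : (N : ℝ) < (m * n : ℕ) := by exact_mod_cast hN
    rw [hyperbolicArea, if_neg (by linarith), mul_zero, ENNReal.ofReal_zero]

theorem slopeMeasure_prod_lowerRegion (h : IsPrimeCoding ψ ξ) {k : ℝ} {N : ℕ} (hk : k ≤ N) :
    (slopeMeasure ξ).prod (slopeMeasure ξ) (lowerRegion k) = ENNReal.ofReal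
      (1 / 2 * ∑ j ∈ Finset.Icc 1 N, jumpConvolution ξ j * hyperbolicArea k j) := by
  have h2 := two_mul_prod_lowerRegion (slopeMeasure ξ) k
  rw [h.slopeMeasure_prod_hyperbolicRegion hk] at h2
  rw [ENNReal.ofReal_mul (by norm_num), ← h2, ← mul_assoc, ← ENNReal.ofReal_ofNat 2,
    ← ENNReal.ofReal_mul (by norm_num)]
  norm_num

theorem measureReal_prod_lowerRegion (h : IsPrimeCoding ψ ξ) {k : ℝ} {N : ℕ} (hk : k ≤ N) :
    ((slopeMeasure ξ).prod (slopeMeasure ξ)).real (lowerRegion k) =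
      1 / 2 * ∑ j ∈ Finset.Icc 1 N, jumpConvolution ξ j * hyperbolicArea k j := by
  rw [Measure.real, h.slopeMeasure_prod_lowerRegion hk, ENNReal.toReal_ofReal]
  refine mul_nonneg (by norm_num) (Finset.sum_nonneg fun j hj => ?_)
  have hj0 : (0 : ℝ) < j := by exact_mod_cast (Finset.mem_Icc.1 hj).1
  exact mul_nonneg (h.jumpConvolution_nonneg j) (hyperbolicArea_nonneg hj0)

theorem lowerArea_map (h : IsPrimeCoding ψ ξ) {k : ℝ} (hk0 : 0 ≤ k) :
    lowerArea ψ (ψ k) = ((slopeMeasure ξ).prod (slopeMeasure ξ)).real (lowerRegion k) := by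
  rw [lowerArea, h.codingInv_map hk0, Measure.real, Measure.real,
    h.volume_image_prodMap (measurableSet_lowerRegion k) fun p hp => ⟨hp.1, hp.1.trans hp.2.1⟩]

theorem upperArea_map (h : IsPrimeCoding ψ ξ) {k : ℝ} (hk : 4 ≤ k) (α : ℕ) :
    upperArea ψ α (ψ k) = ((slopeMeasure ξ).prod (slopeMeasure ξ)).real (lowerRegion (α - 4)) -
      ((slopeMeasure ξ).prod (slopeMeasure ξ)).real (lowerRegion (α - k)) := by
  have hadd := prod_upperRegion_add (slopeMeasure ξ) (α := α) hk
  have hfin : (slopeMeasure ξ).prod (slopeMeasure ξ) (lowerRegion (α - 4)) ≠ ⊤ := by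
    rw [h.slopeMeasure_prod_lowerRegion (N := α) (by linarith)]
    exact ENNReal.ofReal_ne_top
  rw [← hadd, ENNReal.add_ne_top] at hfin
  rw [upperArea, h.codingInv_map (by linarith), Measure.real, Measure.real, Measure.real,
    h.volume_image_prodMap (measurableSet_upperRegion α k) fun p hp => ⟨hp.1, hp.1.trans hp.2.1⟩,
    ← hadd, ENNReal.toReal_add hfin.1 hfin.2, add_sub_cancel_right]

end IsPrimeCoding

/-! ### Second derivatives on a set, and those of the areas. -/

namespace HasSecondDerivOn

variable {f f'' g g'' : ℝ → ℝ} {s t : Set ℝ}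

theorem congr (h : HasSecondDerivOn f f'' s) (hf : EqOn g f s) (hf'' : EqOn g'' f'' s) :
    HasSecondDerivOn g g'' s := by
  obtain ⟨f', h1, h2⟩ := h
  exact ⟨f', fun u hu => (h1 u hu).congr hf (hf hu), fun u hu => hf'' hu ▸ h2 u hu⟩

theorem zero : HasSecondDerivOn (fun _ => 0) (fun _ => 0) s :=
  ⟨fun _ => 0, fun _ _ => hasDerivWithinAt_const _ _ _, fun _ _ => hasDerivWithinAt_const _ _ _⟩

theorem const_mul (c : ℝ) (h : HasSecondDerivOn f f'' s) :
    HasSecondDerivOn (fun u => c * f u) (fun u => c * f'' u) s := by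
  obtain ⟨f', h1, h2⟩ := h
  exact ⟨fun u => c * f' u, fun u hu => (h1 u hu).const_mul c, fun u hu => (h2 u hu).const_mul c⟩

theorem const_sub (c : ℝ) (h : HasSecondDerivOn f f'' s) :
    HasSecondDerivOn (fun u => c - f u) (fun u => -f'' u) s := by
  obtain ⟨f', h1, h2⟩ := h
  exact ⟨fun u => -f' u, fun u hu => (h1 u hu).const_sub c, fun u hu => (h2 u hu).fun_neg⟩

theorem add (hf : HasSecondDerivOn f f'' s) (hg : HasSecondDerivOn g g'' s) :
    HasSecondDerivOn (fun u => f u + g u) (fun u => f'' u + g'' u) s := by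
  obtain ⟨f', h1, h2⟩ := hf
  obtain ⟨g', h3, h4⟩ := hg
  exact ⟨fun u => f' u + g' u, fun u hu => (h1 u hu).fun_add (h3 u hu),
    fun u hu => (h2 u hu).fun_add (h4 u hu)⟩

theorem sum {ι : Type*} {F F'' : ι → ℝ → ℝ} (I : Finset ι)
    (h : ∀ i ∈ I, HasSecondDerivOn (F i) (F'' i) s) :
    HasSecondDerivOn (fun u => ∑ i ∈ I, F i u) (fun u => ∑ i ∈ I, F'' i u) s := by
  classical
  induction I using Finset.induction_on with
  | empty => simpa using zero
  | insert a I ha ih =>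
    simp only [Finset.sum_insert ha]
    exact (h a (by simp)).add (ih fun i hi => h i (by simp [hi]))

theorem comp_affine (a b : ℝ) (h : HasSecondDerivOn f f'' s)
    (hmaps : MapsTo (fun u => a * u + b) t s) :
    HasSecondDerivOn (fun u => f (a * u + b)) (fun u => a ^ 2 * f'' (a * u + b)) t := by
  obtain ⟨f', h1, h2⟩ := h
  have hg (u : ℝ) : HasDerivWithinAt (fun u => a * u + b) a t u := by
    simpa using (((hasDerivAt_id u).const_mul a).add_const b).hasDerivWithinAt (s := t)
  refine ⟨fun u => a * f' (a * u + b), fun u hu => ?_, fun u hu => ?_⟩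
  · dsimp only
    rw [mul_comm a (f' _)]
    exact (h1 _ (hmaps hu)).comp u (hg u) hmaps
  · dsimp only
    rw [pow_two, mul_assoc, mul_comm a (f'' _)]
    exact ((h2 _ (hmaps hu)).comp u (hg u) hmaps).const_mul a

theorem unique (h : HasSecondDerivOn f f'' s) (h' : HasSecondDerivOn f g'' s)
    (hs : UniqueDiffOn ℝ s) : EqOn f'' g'' s := by
  obtain ⟨f', h1, h2⟩ := h
  obtain ⟨g', h3, h4⟩ := h'
  have he : EqOn f' g' s := fun u hu => (hs u hu).eq_deriv s (h1 u hu) (h3 u hu)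
  exact fun u hu => (hs u hu).eq_deriv s (h2 u hu) ((h4 u hu).congr he (he hu))

end HasSecondDerivOn

theorem hasSecondDerivOn_hyperbolicArea {n j : ℕ} (hn : 0 < n) (hj : 0 < j) :
    HasSecondDerivOn (fun k => hyperbolicArea k j) (fun k => if j ≤ n then 1 / k else 0)
      (Icc (n : ℝ) (n + 1)) := by
  have hn' : (0 : ℝ) < n := by exact_mod_cast hn
  have hj' : (0 : ℝ) < j := by exact_mod_cast hj
  by_cases hjn : j ≤ n
  · have hmain : HasSecondDerivOn (fun k => k * Real.log (k / j) - k + j) (fun k => 1 / k)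
        (Icc (n : ℝ) (n + 1)) := by
      have hlog {k : ℝ} (hk : 0 < k) : HasDerivAt (fun k => Real.log (k / j)) (1 / k) k := by
        have := ((hasDerivAt_id k).div_const (j : ℝ)).log (div_pos hk hj').ne'
        exact this.congr_deriv (div_div_div_cancel_right₀ hj'.ne' 1 k)
      refine ⟨fun k => Real.log (k / j), fun k hk => ?_, fun k hk =>
        (hlog (hn'.trans_le hk.1)).hasDerivWithinAt⟩
      have hk0 : 0 < k := hn'.trans_le hk.1
      have := ((((hasDerivAt_id k).fun_mul (hlog hk0)).fun_sub (hasDerivAt_id k)).add_const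
        (j : ℝ)).hasDerivWithinAt (s := Icc (n : ℝ) (n + 1))
      refine this.congr_deriv ?_
      change 1 * Real.log (k / j) + k * (1 / k) - 1 = _
      rw [mul_one_div_cancel hk0.ne']
      ring
    refine hmain.congr (fun k hk => ?_) (fun k _ => if_pos hjn)
    have : (j : ℝ) ≤ n := by exact_mod_cast hjn
    exact if_pos (this.trans hk.1)
  · refine HasSecondDerivOn.zero.congr (fun k hk => ?_) (fun k _ => if_neg hjn)
    have hnj : (n : ℝ) + 1 ≤ j := by exact_mod_cast not_le.1 hjn
    unfold hyperbolicArea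
    split_ifs with hjk
    · rw [le_antisymm (hk.2.trans hnj) hjk, div_self hj'.ne']
      simp
    · rfl

/-- Half of the summatory function of the Dirichlet convolution square of the slope jumps. -/
noncomputable def jumpSum (ξ : ℕ → ℝ) (n : ℕ) : ℝ :=
  1 / 2 * ∑ j ∈ Finset.Icc 1 n, jumpConvolution ξ j

namespace IsPrimeCoding

variable {ψ : ℝ → ℝ} {ξ : ℕ → ℝ}

theorem hasSecondDerivOn_measureReal_lowerRegion (h : IsPrimeCoding ψ ξ) {n : ℕ} (hn : 0 < n) :
    HasSecondDerivOn
      (fun k => ((slopeMeasure ξ).prod (slopeMeasure ξ)).real (lowerRegion k))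
      -- The area formula needs `j` up to `n + 1` because the interval is closed; the extra term has
      -- zero second derivative here and is dropped.
      (fun k => jumpSum ξ n / k) (Icc (n : ℝ) (n + 1)) := by
  have key := (HasSecondDerivOn.sum (Finset.Icc 1 (n + 1)) fun j hj =>
    (hasSecondDerivOn_hyperbolicArea hn (Finset.mem_Icc.1 hj).1).const_mul
      (jumpConvolution ξ j)).const_mul (1 / 2)
  refine key.congr (fun k hk => h.measureReal_prod_lowerRegion (by exact_mod_cast hk.2))
    fun k _ => ?_
  dsimp only
  rw [jumpSum, mul_div_assoc, Finset.sum_div,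
    ← Finset.sum_subset (Finset.Icc_subset_Icc_right n.le_succ)]
  · refine congrArg _ (Finset.sum_congr rfl fun j hj => ?_)
    rw [if_pos (Finset.mem_Icc.1 hj).2, mul_one_div]
  · intro j hj hj'
    have hjn : ¬ j ≤ n := fun hle => hj' (Finset.mem_Icc.2 ⟨(Finset.mem_Icc.1 hj).1, hle⟩)
    rw [if_neg hjn, mul_zero]

/-- The slope `1 / ξ n` of the inverse is the source of the factor `1 / ξ n ^ 2` in the second
derivatives. -/
theorem affine_codingInv (h : IsPrimeCoding ψ ξ) (n : ℕ) {u : ℝ}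
    (hu : u ∈ Icc (ψ n) (ψ (n + 1))) :
    codingInv ψ u = (ξ n)⁻¹ * u + (n - (ξ n)⁻¹ * ψ n) ∧ codingInv ψ u ∈ Icc (n : ℝ) (n + 1) ∧
      ψ (codingInv ψ u) = u := by
  have hsub : Icc (n : ℝ) (n + 1) ⊆ Ici 0 := fun x hx => n.cast_nonneg.trans hx.1
  obtain ⟨x, hx, rfl⟩ := intermediate_value_Icc (by linarith : (n : ℝ) ≤ n + 1)
    (h.coding.continuousOn.mono hsub) hu
  rw [h.codingInv_map (hsub hx)]
  refine ⟨?_, hx, rfl⟩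
  have := (h.coeff_pos n).ne'
  rw [h.affine n x hx, h.map_natCast]
  field_simp
  ring

theorem hasSecondDerivOn_lowerArea (h : IsPrimeCoding ψ ξ) {n : ℕ} (hn : 0 < n) :
    HasSecondDerivOn (lowerArea ψ)
      (fun u => 1 / (ξ n ^ 2 * codingInv ψ u) * jumpSum ξ n) (Icc (ψ n) (ψ (n + 1))) := by
  refine ((h.hasSecondDerivOn_measureReal_lowerRegion hn).comp_affine (ξ n)⁻¹
    (n - (ξ n)⁻¹ * ψ n) (t := Icc (ψ n) (ψ (n + 1))) fun u hu => ?_).congr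
      (fun u hu => ?_) (fun u hu => ?_)
  all_goals obtain ⟨h1, h2, h3⟩ := h.affine_codingInv n hu
  · dsimp only
    rwa [← h1]
  · dsimp only
    rw [← h1, ← h.lowerArea_map (n.cast_nonneg.trans h2.1), h3]
  · dsimp only
    rw [← h1]
    field_simp

/-- As `k` runs over `[n, n + 1]`, `α - k` runs over `[α - n - 1, α - n]`, hence the index `α - n -
1`; the sign comes from subtracting the lower area. -/
theorem hasSecondDerivOn_upperArea (h : IsPrimeCoding ψ ξ) {α n : ℕ} (hn : 4 ≤ n)
    (hα : n + 1 < α) :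
    HasSecondDerivOn (upperArea ψ α)
      (fun u => 1 / (ξ n ^ 2 * (α - codingInv ψ u)) * -jumpSum ξ (α - n - 1))
      (Icc (ψ n) (ψ (n + 1))) := by
  have hcast : ((α - n - 1 : ℕ) : ℝ) = α - n - 1 := by
    rw [Nat.cast_sub (by omega), Nat.cast_sub (by omega), Nat.cast_one]
  have haff (u : ℝ) : -(ξ n)⁻¹ * u + (α - (n - (ξ n)⁻¹ * ψ n)) =
      α - ((ξ n)⁻¹ * u + (n - (ξ n)⁻¹ * ψ n)) := by ring
  refine (((h.hasSecondDerivOn_measureReal_lowerRegion (n := α - n - 1) (by omega)).comp_affine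
    (-(ξ n)⁻¹) (α - (n - (ξ n)⁻¹ * ψ n)) (t := Icc (ψ n) (ψ (n + 1))) fun u hu => ?_).const_sub
      (((slopeMeasure ξ).prod (slopeMeasure ξ)).real (lowerRegion (α - 4)))).congr
      (fun u hu => ?_) (fun u hu => ?_)
  all_goals obtain ⟨h1, h2, h3⟩ := h.affine_codingInv n hu
  · dsimp only
    rw [haff, ← h1, hcast]
    exact ⟨by linarith [h2.2], by linarith [h2.1]⟩
  · dsimp only
    have hn4 : (4 : ℝ) ≤ n := by exact_mod_cast hn
    rw [haff, ← h1, ← h.upperArea_map (hn4.trans h2.1), h3]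
  · dsimp only
    rw [haff, ← h1]
    field_simp

theorem map_natCast_lt (h : IsPrimeCoding ψ ξ) (n : ℕ) : ψ n < ψ (n + 1) :=
  h.strictMonoOn (mem_Ici.2 n.cast_nonneg) (mem_Ici.2 (by positivity)) (by linarith)

end IsPrimeCoding

/-! ### Existence and uniqueness of the essential polynomials. -/

/-- The piecewise affine function with slope `ξ m` on `[m, m + 1]`. -/
noncomputable def codingOfCoeffs (ξ : ℕ → ℝ) (x : ℝ) : ℝ :=
  ξ ⌊x⌋₊ * (x - ⌊x⌋₊) + ∑ j ∈ Finset.range ⌊x⌋₊, ξ j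

theorem codingOfCoeffs_affine (ξ : ℕ → ℝ) (m : ℕ) {x : ℝ} (hx : x ∈ Icc (m : ℝ) (m + 1)) :
    codingOfCoeffs ξ x = ξ m * (x - m) + ∑ j ∈ Finset.range m, ξ j := by
  have hx0 : 0 ≤ x := m.cast_nonneg.trans hx.1
  rcases hx.2.lt_or_eq with hlt | rfl
  · rw [codingOfCoeffs, (Nat.floor_eq_iff hx0).2 ⟨hx.1, hlt⟩]
  · have : ⌊(m : ℝ) + 1⌋₊ = m + 1 := by exact_mod_cast Nat.floor_natCast (R := ℝ) (m + 1)
    rw [codingOfCoeffs, this, Finset.sum_range_succ]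
    push_cast
    ring

/-- Uniqueness of the polynomials requires every admissible sequence to come from some prime coding.
-/
theorem isPrimeCoding_codingOfCoeffs {ξ : ℕ → ℝ} (h0 : 0 < ξ 0) (hmono : StrictMono ξ) :
    IsPrimeCoding (codingOfCoeffs ξ) ξ := by
  have haff (m : ℕ) : EqOn (codingOfCoeffs ξ)
      (fun x => ξ m * (x - m) + ∑ j ∈ Finset.range m, ξ j) (Icc (m : ℝ) (m + 1)) :=
    fun x hx => codingOfCoeffs_affine ξ m hx
  refine ⟨⟨by simp [codingOfCoeffs], ?_, fun m => ?_, fun m x hx => ?_⟩, fun m x hx => haff m hx,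
    h0, hmono⟩
  · have hcover : Ici (0 : ℝ) ⊆ ⋃ m : ℕ, Icc (m : ℝ) (m + 1) := fun x hx =>
      mem_iUnion.2 ⟨⌊x⌋₊, Nat.floor_le hx, (Nat.lt_floor_add_one x).le⟩
    refine ContinuousOn.mono (LocallyFinite.continuousOn_iUnion ?_ (fun _ => isClosed_Icc)
      fun m => ?_) hcover
    · intro x
      obtain ⟨N, hN⟩ := exists_nat_gt x
      refine ⟨Iio (N : ℝ), Iio_mem_nhds hN, (finite_Iio N).subset ?_⟩
      rintro m ⟨y, ⟨hy, -⟩, hyN⟩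
      exact_mod_cast hy.trans_lt hyN
    · exact ContinuousOn.congr (by fun_prop) (haff m)
  · exact ContDiffOn.congr (by fun_prop) (haff m)
  · have hd : HasDerivAt (fun x => ξ m * (x - m) + ∑ j ∈ Finset.range m, ξ j) (ξ m) x := by
      simpa using (((hasDerivAt_id x).sub_const (m : ℝ)).const_mul (ξ m)).add_const
        (∑ j ∈ Finset.range m, ξ j)
    rw [(hd.hasDerivWithinAt.congr (haff m) (haff m hx)).derivWithin
      (uniqueDiffOn_Icc (by linarith) x hx)]
    exact h0.trans_le (hmono.monotone m.zero_le)

/-- A polynomial is determined by its values at the coefficients of prime codings. -/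
theorem MvPolynomial.eq_of_eval_eq_on_strictMono {P Q : MvPolynomial ℕ ℝ}
    (h : ∀ ξ : ℕ → ℝ, 0 < ξ 0 → StrictMono ξ → MvPolynomial.eval ξ P = MvPolynomial.eval ξ Q) :
    P = Q := by
  -- A product of infinite sets detects polynomials; consecutive disjoint intervals make every point
  -- of it positive and increasing.
  refine MvPolynomial.funext_set (fun m : ℕ => Ioo (m : ℝ) (m + 1))
    (fun m => Ioo_infinite (by linarith)) fun ξ hξ => h ξ ?_ (strictMono_nat_of_lt_succ fun m => ?_)
  · simpa using (hξ 0 (mem_univ 0)).1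
  · have := (hξ (m + 1) (mem_univ _)).1
    push_cast at this
    exact (hξ m (mem_univ m)).2.trans this

/-- The polynomial whose value at the coefficients of a prime coding is `jumpSum`. -/
noncomputable def essentialPolynomial (n : ℕ) : MvPolynomial ℕ ℝ :=
  MvPolynomial.C (1 / 2) * ∑ j ∈ Finset.Icc 1 n, jumpConvolution MvPolynomial.X j

theorem eval_essentialPolynomial (ξ : ℕ → ℝ) (n : ℕ) :
    MvPolynomial.eval ξ (essentialPolynomial n) = jumpSum ξ n := by
  simp [essentialPolynomial, jumpSum, jumpConvolution, map_slopeJump]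

theorem isHomogeneous_slopeJump (m : ℕ) :
    (slopeJump (MvPolynomial.X : ℕ → MvPolynomial ℕ ℝ) m).IsHomogeneous 1 := by
  unfold slopeJump
  split_ifs
  · exact MvPolynomial.isHomogeneous_zero _ _ _
  · exact MvPolynomial.isHomogeneous_X _ _
  · exact (MvPolynomial.isHomogeneous_X _ _).sub (MvPolynomial.isHomogeneous_X _ _)

theorem isHomogeneous_essentialPolynomial (n : ℕ) : (essentialPolynomial n).IsHomogeneous 2 :=
  (MvPolynomial.IsHomogeneous.sum _ _ _ fun _ _ => MvPolynomial.IsHomogeneous.sum _ _ _ fun _ _ =>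
    (isHomogeneous_slopeJump _).mul (isHomogeneous_slopeJump _)).C_mul _

theorem isLowerEssentialPolynomial_essentialPolynomial {n : ℕ} (hn : 0 < n) :
    IsLowerEssentialPolynomial n (essentialPolynomial n) := fun ψ ξ h => by
  simpa only [eval_essentialPolynomial] using h.hasSecondDerivOn_lowerArea hn

theorem isUpperEssentialPolynomial_essentialPolynomial {α n : ℕ} (hn : 4 ≤ n) (hα : n + 1 < α) :
    IsUpperEssentialPolynomial α n (-essentialPolynomial (α - n - 1)) := fun ψ ξ h => by
  simpa only [map_neg, eval_essentialPolynomial] using h.hasSecondDerivOn_upperArea hn hα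

namespace IsPrimeCoding

variable {ψ : ℝ → ℝ} {ξ : ℕ → ℝ}

theorem uniqueDiffOn_Icc (h : IsPrimeCoding ψ ξ) (n : ℕ) :
    UniqueDiffOn ℝ (Icc (ψ n) (ψ (n + 1))) :=
  _root_.uniqueDiffOn_Icc (h.map_natCast_lt n)

theorem map_mem_Icc (h : IsPrimeCoding ψ ξ) {n : ℕ} {k : ℝ} (hk : k ∈ Icc (n : ℝ) (n + 1)) :
    ψ k ∈ Icc (ψ n) (ψ (n + 1)) := by
  have h0 : (0 : ℝ) ≤ n := n.cast_nonneg
  have hm := h.strictMonoOn.monotoneOn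
  exact ⟨hm h0 (h0.trans hk.1) hk.1, hm (h0.trans hk.1) (mem_Ici.2 (by linarith)) hk.2⟩

end IsPrimeCoding

theorem IsLowerEssentialPolynomial.eq {n : ℕ} (hn : 0 < n) {P Q : MvPolynomial ℕ ℝ}
    (hP : IsLowerEssentialPolynomial n P) (hQ : IsLowerEssentialPolynomial n Q) : P = Q := by
  refine MvPolynomial.eq_of_eval_eq_on_strictMono fun ξ h0 hmono => ?_
  have h := isPrimeCoding_codingOfCoeffs h0 hmono
  have hmem := h.map_mem_Icc (n := n) (k := n) (by simp)
  have key := (hP _ ξ h).unique (hQ _ ξ h) (h.uniqueDiffOn_Icc n) hmem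
  dsimp only at key
  rw [h.codingInv_map n.cast_nonneg] at key
  have hn' : (0 : ℝ) < n := by exact_mod_cast hn
  exact mul_left_cancel₀ (one_div_pos.2 (mul_pos (pow_pos (h.coeff_pos n) 2) hn')).ne' key

theorem IsUpperEssentialPolynomial.eq {α n : ℕ} (hα : n < α) {P Q : MvPolynomial ℕ ℝ}
    (hP : IsUpperEssentialPolynomial α n P) (hQ : IsUpperEssentialPolynomial α n Q) : P = Q := by
  refine MvPolynomial.eq_of_eval_eq_on_strictMono fun ξ h0 hmono => ?_
  have h := isPrimeCoding_codingOfCoeffs h0 hmono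
  have hmem := h.map_mem_Icc (n := n) (k := n) (by simp)
  have key := (hP _ ξ h).unique (hQ _ ξ h) (h.uniqueDiffOn_Icc n) hmem
  dsimp only at key
  rw [h.codingInv_map n.cast_nonneg] at key
  have hn' : (0 : ℝ) < α - n := sub_pos.2 (by exact_mod_cast hα)
  exact mul_left_cancel₀ (one_div_pos.2 (mul_pos (pow_pos (h.coeff_pos n) 2) hn')).ne' key

/-- With denominators cleared, `(x - x') (α - k) + (y - y') k` vanishes on the interval; its values
at the two end points already force both differences to be zero. -/
theorem TotalAreaHasCoefficients.unique {ψ : ℝ → ℝ} {ξ : ℕ → ℝ} (h : IsPrimeCoding ψ ξ)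
    {α n : ℕ} (hn : 0 < n) (hα : n + 1 < α) {x y x' y' : ℝ}
    (h1 : TotalAreaHasCoefficients ψ ξ α n x y) (h2 : TotalAreaHasCoefficients ψ ξ α n x' y') :
    x = x' ∧ y = y' := by
  have hn' : (0 : ℝ) < n := by exact_mod_cast hn
  have hα' : (n : ℝ) + 1 < α := by exact_mod_cast hα
  have key {k : ℝ} (hk : k ∈ Icc (n : ℝ) (n + 1)) :
      (x - x') * (α - k) + (y - y') * k = 0 := by
    have hk0 : 0 < k := hn'.trans_le hk.1
    have hkα : 0 < α - k := by linarith [hk.2]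
    have := HasSecondDerivOn.unique h1 h2 (h.uniqueDiffOn_Icc n) (h.map_mem_Icc hk)
    dsimp only at this
    rw [h.codingInv_map hk0.le] at this
    have hξ := h.coeff_pos n
    field_simp at this
    linarith
  have e1 := key (k := n) ⟨le_rfl, by linarith⟩
  have e2 := key (k := n + 1) ⟨by linarith, le_rfl⟩
  have hyx : y - y' = x - x' := by linarith
  rw [hyx] at e1
  have hx : (x - x') * α = 0 := by linarith
  have hx0 : x - x' = 0 := (mul_eq_zero.1 hx).resolve_right (by linarith)
  exact ⟨by linarith, by linarith⟩

/-! ### Monotonicity and primes. -/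

theorem jumpSum_eq_add (ξ : ℕ → ℝ) {n : ℕ} (hn : 0 < n) :
    jumpSum ξ n = jumpSum ξ (n - 1) + 1 / 2 * jumpConvolution ξ n := by
  obtain ⟨m, rfl⟩ := Nat.exists_eq_succ_of_ne_zero hn.ne'
  rw [jumpSum, jumpSum, Nat.succ_sub_one, Finset.sum_Icc_succ_top (by omega), mul_add]

namespace IsPrimeCoding

variable {ψ : ℝ → ℝ} {ξ : ℕ → ℝ}

/-- All terms are nonnegative. A composite has a factorization with both jumps positive, while for a
prime one factor is `1`, where the jump is zero. -/
theorem jumpConvolution_eq_zero_iff (h : IsPrimeCoding ψ ξ) {n : ℕ} (hn : 2 ≤ n) :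
    jumpConvolution ξ n = 0 ↔ n.Prime := by
  rw [jumpConvolution, Finset.sum_eq_zero_iff_of_nonneg fun p _ =>
    mul_nonneg (h.slopeJump_nonneg p.1) (h.slopeJump_nonneg p.2)]
  constructor
  · intro hzero
    by_contra hprime
    obtain ⟨a, ⟨b, rfl⟩, ha2, han⟩ := (Nat.not_prime_iff_exists_dvd_lt hn).1 hprime
    have hb2 : 2 ≤ b := by
      by_contra! hb
      interval_cases b <;> omega
    exact (mul_pos (h.slopeJump_pos ha2) (h.slopeJump_pos hb2)).ne'
      (hzero (a, b) (Nat.mem_divisorsAntidiagonal.2 ⟨rfl, by omega⟩))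
  · rintro hp ⟨a, b⟩ hab
    obtain ⟨hab, -⟩ := Nat.mem_divisorsAntidiagonal.1 hab
    rcases (Nat.prime_mul_iff.1 (hab ▸ hp)) with ⟨-, hb⟩ | ⟨-, ha⟩
    · rw [hb, slopeJump_of_lt ξ one_lt_two, mul_zero]
    · rw [ha, slopeJump_of_lt ξ one_lt_two, zero_mul]

theorem jumpSum_pos (h : IsPrimeCoding ψ ξ) {n : ℕ} (hn : 4 ≤ n) : 0 < jumpSum ξ n := by
  -- The first composite, `4`, gives a strictly positive term.
  refine mul_pos (by norm_num) (Finset.sum_pos' (fun j _ => h.jumpConvolution_nonneg j)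
    ⟨4, Finset.mem_Icc.2 ⟨by norm_num, hn⟩, (h.jumpConvolution_nonneg 4).lt_of_ne' ?_⟩)
  rw [ne_eq, h.jumpConvolution_eq_zero_iff (by norm_num)]
  norm_num

theorem jumpSum_pred_le (h : IsPrimeCoding ψ ξ) {n : ℕ} (hn : 2 ≤ n) :
    jumpSum ξ (n - 1) ≤ jumpSum ξ n := by
  rw [jumpSum_eq_add ξ (by omega : 0 < n)]
  linarith [h.jumpConvolution_nonneg n]

theorem jumpSum_pred_eq_iff (h : IsPrimeCoding ψ ξ) {n : ℕ} (hn : 2 ≤ n) :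
    jumpSum ξ (n - 1) = jumpSum ξ n ↔ n.Prime := by
  rw [← h.jumpConvolution_eq_zero_iff hn, jumpSum_eq_add ξ (by omega : 0 < n)]
  constructor <;> intro <;> linarith

end IsPrimeCoding

theorem theorem2p8p2 (α : ℕ) (hα : Even α) (h16 : 16 ≤ α) :
    -- the essential polynomials exist and are unique
    (∀ k₀ ∈ Finset.Icc 4 (α / 2 - 1),
      (∃! P : MvPolynomial ℕ ℝ, IsLowerEssentialPolynomial k₀ P) ∧
      (∃! Q : MvPolynomial ℕ ℝ, IsUpperEssentialPolynomial α k₀ Q)) ∧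
    ∀ P Q : ℕ → MvPolynomial ℕ ℝ,
      (∀ k₀ ∈ Finset.Icc 4 (α / 2 - 1),
        IsLowerEssentialPolynomial k₀ (P k₀) ∧ IsUpperEssentialPolynomial α k₀ (Q k₀)) →
      (∀ k₀ ∈ Finset.Icc 4 (α / 2 - 1),
        (P k₀).IsHomogeneous 2 ∧ (Q k₀).IsHomogeneous 2) ∧
      ∀ (ψ : ℝ → ℝ) (ξ : ℕ → ℝ), IsPrimeCoding ψ ξ →
        -- the coordinates of the essential points
        ∀ x y : ℕ → ℝ, (∀ k₀, x k₀ = MvPolynomial.eval ξ (P k₀)) →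
          (∀ k₀, y k₀ = MvPolynomial.eval ξ (Q k₀)) →
          -- they are the coefficients in the second derivative of the total area
          (∀ k₀ ∈ Finset.Icc 4 (α / 2 - 1),
            TotalAreaHasCoefficients ψ ξ α k₀ (x k₀) (y k₀) ∧
            ∀ x' y' : ℝ, TotalAreaHasCoefficients ψ ξ α k₀ x' y' → x' = x k₀ ∧ y' = y k₀) ∧
          -- (i)
          (0 < x 4 ∧
            ∀ k₀ ∈ Finset.Icc 5 (α / 2 - 1),
              x (k₀ - 1) ≤ x k₀ ∧ (x (k₀ - 1) = x k₀ ↔ k₀.Prime)) ∧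
          -- (ii)
          (y (α / 2 - 1) < 0 ∧
            ∀ k₀ ∈ Finset.Icc 5 (α / 2 - 1),
              y (k₀ - 1) ≤ y k₀ ∧ (y (k₀ - 1) = y k₀ ↔ (α - k₀).Prime)) := by
  have hlower {k : ℕ} (hk : k ∈ Finset.Icc 4 (α / 2 - 1)) :
      IsLowerEssentialPolynomial k (essentialPolynomial k) :=
    isLowerEssentialPolynomial_essentialPolynomial
      (by have := Finset.mem_Icc.1 hk; omega)
  have hupper {k : ℕ} (hk : k ∈ Finset.Icc 4 (α / 2 - 1)) :
      IsUpperEssentialPolynomial α k (-essentialPolynomial (α - k - 1)) :=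
    isUpperEssentialPolynomial_essentialPolynomial (Finset.mem_Icc.1 hk).1
      (by have := Finset.mem_Icc.1 hk; omega)
  have hlower_eq {k : ℕ} (hk : k ∈ Finset.Icc 4 (α / 2 - 1)) {P : MvPolynomial ℕ ℝ}
      (hP : IsLowerEssentialPolynomial k P) : P = essentialPolynomial k :=
    hP.eq (by have := Finset.mem_Icc.1 hk; omega) (hlower hk)
  have hupper_eq {k : ℕ} (hk : k ∈ Finset.Icc 4 (α / 2 - 1)) {P : MvPolynomial ℕ ℝ}
      (hP : IsUpperEssentialPolynomial α k P) : P = -essentialPolynomial (α - k - 1) :=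
    hP.eq (by have := Finset.mem_Icc.1 hk; omega) (hupper hk)
  refine ⟨fun k hk => ⟨⟨_, hlower hk, fun P hP => hlower_eq hk hP⟩,
    ⟨_, hupper hk, fun P hP => hupper_eq hk hP⟩⟩, fun P Q hPQ => ⟨fun k hk => ?_, ?_⟩⟩
  · rw [hlower_eq hk (hPQ k hk).1, hupper_eq hk (hPQ k hk).2]
    exact ⟨isHomogeneous_essentialPolynomial _, (isHomogeneous_essentialPolynomial _).neg⟩
  intro ψ ξ h x y hx hy
  have hxk {k : ℕ} (hk : k ∈ Finset.Icc 4 (α / 2 - 1)) : x k = jumpSum ξ k := by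
    rw [hx, hlower_eq hk (hPQ k hk).1, eval_essentialPolynomial]
  have hyk {k : ℕ} (hk : k ∈ Finset.Icc 4 (α / 2 - 1)) : y k = -jumpSum ξ (α - k - 1) := by
    rw [hy, hupper_eq hk (hPQ k hk).2, map_neg, eval_essentialPolynomial]
  refine ⟨fun k hk => ?_, ⟨?_, fun k hk => ?_⟩, ?_, fun k hk => ?_⟩
  · have hcoeff : TotalAreaHasCoefficients ψ ξ α k (x k) (y k) := by
      rw [hx, hy]
      exact ((hPQ k hk).1 ψ ξ h).add ((hPQ k hk).2 ψ ξ h)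
    have hk' := Finset.mem_Icc.1 hk
    exact ⟨hcoeff, fun x' y' h' =>
      TotalAreaHasCoefficients.unique h (by omega) (by omega) h' hcoeff⟩
  · rw [hxk (Finset.mem_Icc.2 (by omega))]
    exact h.jumpSum_pos le_rfl
  · have hk' := Finset.mem_Icc.1 hk
    rw [hxk (Finset.mem_Icc.2 (by omega)), hxk (Finset.mem_Icc.2 (by omega))]
    exact ⟨h.jumpSum_pred_le (by omega), h.jumpSum_pred_eq_iff (by omega)⟩
  · rw [hyk (Finset.mem_Icc.2 (by omega)), neg_lt_zero]
    exact h.jumpSum_pos (by omega)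
  · have hk' := Finset.mem_Icc.1 hk
    -- The indices for `k - 1` and `k` are `α - k` and `α - k - 1`, so primality is tested at `α -
    -- k`; the negation reverses the order.
    rw [hyk (Finset.mem_Icc.2 (by omega)), hyk (Finset.mem_Icc.2 (by omega)),
      show α - (k - 1) - 1 = α - k by omega, neg_le_neg_iff, neg_inj, eq_comm]
    exact ⟨h.jumpSum_pred_le (by omega), h.jumpSum_pred_eq_iff (by omega)⟩
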